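/- Let $M\ge 0$ and $N\ge 1$ be integers, $\beta>0$, and $\lambda_S,\lambda_R,\mu\ge 0$. Let $\Gamma_{M+N}(\vec v,\vec w)=\prod_{i=1}^M\gamma(v_i)\prod_{j=1}^N\gamma(w_j)$ with $\gamma(x)=\sqrt{\beta/2\pi}\,e^{-\beta x^2/2}$, and let $\|\cdot\|_2$ be the norm of the real space $L^2(\mathbb R^{M+N},\Gamma_{M+N}\,d\vec v\,d\vec w)$. For two distinct particles $a,b$ among the $M$ system particles (velocities $v_1,\dots,v_M$) and the $N$ reservoir particles (velocities $w_1,\dots,w_N$), let $R_{a,b}h$ be the average over $\theta\in[0,2\pi]$, with respect to $d\theta/2\pi$, of the function $h$ evaluated at the configuration in which the velocities $x_a,x_b$ of $a,b$ are replaced by $$x_a\cos\theta+x_b\sin\theta,\qquad -x_a\sin\theta+x_b\cos\theta .$$ Write $R^S_{i,j}$, $R^R_{i,j}$, $R^I_{i,j}$ when $a,b$ are the system particles $i,j$; the reservoir particles $i,j$; the system particle $i$ and the reservoir particle $j$, respectively. For $1\le i\le M$ let $$T_ih(\vec v,\vec w)=\int_{\mathbb R}\gamma(u)\,\frac1{2\pi}\int_0^{2\pi}h(v_1,\dots,v_i\cos\theta+u\sin\theta,\dots,v_M,\vec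 w)\,d\theta\,du .$$ On $L^2(\Gamma_{M+N})$ consider the bounded operators $$\mathcal L_S=\frac{\lambda_S}{M-1}\sum_{1\le i<j\le M}(R^S_{i,j}-I),\qquad \mathcal L_R=\frac{\lambda_R}{N-1}\sum_{1\le i<j\le N}(R^R_{i,j}-I),$$ $$\mathcal L_I=\frac{\mu}{N}\sum_{i=1}^M\sum_{j=1}^N(R^I_{i,j}-I),\qquad \mathcal L_T=\mu\sum_{i=1}^M(T_i-I)$$ (empty sums being $0$), the generator $\mathcal L=\mathcal L_S+\mathcal L_R+\mathcal L_I$ of the system coupled to the finite reservoir, and the generator $\overline{\mathcal L}=\mathcal L_S+\mathcal L_R+\mathcal L_T$ of the system coupled to the Maxwellian thermostat, both acting on densities relative to $\Gamma_{M+N}$. Let $h_0$ be a real function of $\vec v\in\mathbb R^M$ only which, regarded as a function of $(\vec v,\vec w)$, belongs to $L^2(\Gamma_{M+N})$; thus the initial density is $f_0(\vec v,\vec w)=h_0(\vec v)\,\Gamma_{M+N}(\vec v,\vec w)$, with the reservoir in equilibrium. Then for every $t>0$ $$\bigl\|e^{\overline{\mathcal L}t}h_0-e^{\mathcal Lt}h_0\bigr\|_2\le\frac{M}{\sqrt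 N}\bigl(1-e^{-\mu t/2}\bigr)\,\|h_0-1\|_2 .$$ -/

import Mathlib

open MeasureTheory ProbabilityTheory
open scoped NNReal ENNReal

noncomputable section

namespace KacReservoir

/-! ### Averaging operators on `L²` -/

section AverageOp

set_option linter.unusedSectionVars false

variable {X Θ : Type*} [MeasurableSpace X] [MeasurableSpace Θ]

/-- `(average ν φ f)(x) = ∫ f(φ(x,θ)) dν(θ)`. -/
def average (ν : Measure Θ) (φ : X × Θ → X) (f : X → ℝ) (x : X) : ℝ :=
  ∫ θ, f (φ (x, θ)) ∂ν

variable {m : Measure X} {ν : Measure Θ} [IsFiniteMeasure m] [IsProbabilityMeasure ν]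
  {φ : X × Θ → X}

theorem aestronglyMeasurable_average (hφ : MeasurePreserving φ (m.prod ν) m) {f : X → ℝ}
    (hf : MemLp f 2 m) : AEStronglyMeasurable (average ν φ f) m :=
  (hf.comp_measurePreserving hφ).aestronglyMeasurable.integral_prod_right'

theorem eLpNorm_average_le (hφ : MeasurePreserving φ (m.prod ν) m) {f : X → ℝ}
    (hf : MemLp f 2 m) : eLpNorm (average ν φ f) 2 m ≤ eLpNorm f 2 m := by
  have hg : MemLp (f ∘ φ) 2 (m.prod ν) := hf.comp_measurePreserving hφ
  rw [← eLpNorm_comp_measurePreserving hf.aestronglyMeasurable hφ]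
  simp only [eLpNorm_eq_lintegral_rpow_enorm_toReal (p := 2) (by norm_num) (by norm_num)]
  refine ENNReal.rpow_le_rpow ?_ (by norm_num)
  rw [lintegral_prod _ (by
    simpa using (hg.aestronglyMeasurable.enorm.pow_const (2 : ℝ)))]
  refine lintegral_mono_ae ?_
  filter_upwards [hg.aestronglyMeasurable.prodMk_left] with x hx
  have h1 : ‖average ν φ f x‖ₑ ≤ eLpNorm (fun θ => (f ∘ φ) (x, θ)) 1 ν := by
    rw [eLpNorm_one_eq_lintegral_enorm]
    exact enorm_integral_le_lintegral_enorm _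
  have h2 := h1.trans (eLpNorm_le_eLpNorm_of_exponent_le (q := 2) (by norm_num) hx)
  rw [eLpNorm_eq_lintegral_rpow_enorm_toReal (p := 2) (by norm_num) (by norm_num)] at h2
  refine (ENNReal.rpow_le_rpow h2 (by norm_num : (0 : ℝ) ≤ (2 : ℝ≥0∞).toReal)).trans ?_
  rw [← ENNReal.rpow_mul]
  simp

theorem memLp_average (hφ : MeasurePreserving φ (m.prod ν) m) {f : X → ℝ}
    (hf : MemLp f 2 m) : MemLp (average ν φ f) 2 m :=
  ⟨aestronglyMeasurable_average hφ hf, (eLpNorm_average_le hφ hf).trans_lt hf.2⟩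

theorem average_congr (hφ : MeasurePreserving φ (m.prod ν) m) {f g : X → ℝ}
    (h : f =ᵐ[m] g) : average ν φ f =ᵐ[m] average ν φ g := by
  have := hφ.quasiMeasurePreserving.ae_eq_comp h
  filter_upwards [Measure.ae_ae_of_ae_prod this] with x hx
  exact integral_congr_ae hx

theorem ae_integrable_slice (hφ : MeasurePreserving φ (m.prod ν) m) {f : X → ℝ}
    (hf : MemLp f 2 m) : ∀ᵐ x ∂m, Integrable (fun θ => f (φ (x, θ))) ν :=
  ((hf.comp_measurePreserving hφ).integrable (by norm_num)).prod_right_ae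

/-- The bounded operator on `L²(m)` induced by `average ν φ`, where `φ` carries the product of `m`
and the probability measure `ν` to `m`. -/
def averageOp (hφ : MeasurePreserving φ (m.prod ν) m) : Lp ℝ 2 m →L[ℝ] Lp ℝ 2 m :=
  LinearMap.mkContinuous
    { toFun := fun f => (memLp_average hφ (Lp.memLp f)).toLp (average ν φ f)
      map_add' := by
        intro f g
        rw [← MemLp.toLp_add]
        refine (MemLp.toLp_eq_toLp_iff _ _).2 ?_
        filter_upwards [average_congr hφ (Lp.coeFn_add f g),
          ae_integrable_slice hφ (Lp.memLp f), ae_integrable_slice hφ (Lp.memLp g)] with x h hf hg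
        rw [h]
        exact integral_add hf hg
      map_smul' := by
        intro c f
        rw [RingHom.id_apply, ← MemLp.toLp_const_smul]
        refine (MemLp.toLp_eq_toLp_iff _ _).2 ?_
        filter_upwards [average_congr hφ (Lp.coeFn_smul c f)] with x h
        rw [h]
        exact integral_smul c _ }
    1 (by
      intro f
      rw [one_mul]
      change ‖(memLp_average hφ (Lp.memLp f)).toLp (average ν φ f)‖ ≤ ‖f‖
      rw [Lp.norm_toLp, Lp.norm_def]
      exact ENNReal.toReal_mono (Lp.eLpNorm_ne_top f) (eLpNorm_average_le hφ (Lp.memLp f)))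

end AverageOp

/-! ### Maxwellian measures and collisions -/

/-- The law of one Maxwellian velocity at inverse temperature `β`: for `β > 0` it has density
`√(β/2π) exp(-β w²/2)`. -/
def maxwell (β : ℝ≥0) : Measure ℝ := gaussianReal 0 β⁻¹

instance (β : ℝ≥0) : IsProbabilityMeasure (maxwell β) :=
  inferInstanceAs (IsProbabilityMeasure (gaussianReal 0 β⁻¹))

/-- Velocities `(v, w)` of the `M` system particles (left summand) and of the `N` reservoir
particles (right summand). -/
abbrev Velocities (M N : ℕ) : Type := Fin M ⊕ Fin N → ℝ

/-- The Maxwellian measure `Γ_{M+N}(v,w) dv dw` at inverse temperature `β`. -/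
def maxwellian (β : ℝ≥0) (M N : ℕ) : Measure (Velocities M N) :=
  Measure.pi fun _ => maxwell β

instance (β : ℝ≥0) (M N : ℕ) : IsProbabilityMeasure (maxwellian β M N) :=
  inferInstanceAs (IsProbabilityMeasure (Measure.pi fun _ => maxwell β))

/-- The uniform probability measure on the angles `(0, 2π]`. -/
def uniformAngle : Measure ℝ := cond volume (Set.Ioc 0 (2 * Real.pi))

instance : IsProbabilityMeasure uniformAngle :=
  cond_isProbabilityMeasure_of_finite (by simp [Real.pi_pos]) measure_Ioc_lt_top.ne

section Maps

variable {ι : Type*} [DecidableEq ι]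

/-- The velocities after a collision of the particles `a` and `b` with angle `θ`, as a function of
the pair (velocities, angle). -/
def collisionMap (a b : ι) (p : (ι → ℝ) × ℝ) : ι → ℝ := fun k =>
  if k = a then p.1 a * Real.cos p.2 + p.1 b * Real.sin p.2
  else if k = b then -p.1 a * Real.sin p.2 + p.1 b * Real.cos p.2
  else p.1 k

/-- The velocities after particle `a` has collided, with angle `θ`, with an external particle of
velocity `w`, as a function of (velocities, (`w`, `θ`)). -/
def thermostatMap (a : ι) (p : (ι → ℝ) × (ℝ × ℝ)) : ι → ℝ :=
  Function.update p.1 a (p.1 a * Real.cos p.2.2 + p.2.1 * Real.sin p.2.2)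

theorem measurable_collisionMap (a b : ι) : Measurable (collisionMap a b) := by
  refine measurable_pi_lambda _ fun k => ?_
  unfold collisionMap
  split_ifs <;> fun_prop

theorem measurable_thermostatMap (a : ι) : Measurable (thermostatMap a) := by
  refine measurable_pi_lambda _ fun k => ?_
  by_cases h : k = a
  · subst h
    simp only [thermostatMap, Function.update_self]
    fun_prop
  · simp only [thermostatMap, Function.update_of_ne h]
    fun_prop

variable [Fintype ι]

theorem charFunDual_maxwell (β : ℝ≥0) (L : StrongDual ℝ ℝ) :
    charFunDual (maxwell β) L = Complex.exp (-((β⁻¹ : ℝ≥0) : ℂ) / 2 * ((L 1 : ℝ) : ℂ) ^ 2) := by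
  have hL : ∀ x, L x = x * L 1 := fun x => by
    rw [← smul_eq_mul, ← map_smul, smul_eq_mul, mul_one]
  have := charFun_gaussianReal (μ := 0) (v := β⁻¹) (L 1)
  rw [charFun_apply_real] at this
  rw [charFunDual_apply, maxwell]
  have h2 : ∀ x : ℝ, Complex.exp ((L x : ℝ) * Complex.I) =
      Complex.exp ((L 1 : ℝ) * (x : ℂ) * Complex.I) := fun x => by
    rw [hL x, Complex.ofReal_mul, mul_comm ((x : ℝ) : ℂ)]
  rw [integral_congr_ae (Filter.Eventually.of_forall h2), this]
  congr 1
  push_cast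
  ring

theorem charFunDual_pi_maxwell (β : ℝ≥0) (L : StrongDual ℝ (ι → ℝ)) :
    charFunDual (Measure.pi fun _ : ι => maxwell β) L =
      Complex.exp (-((β⁻¹ : ℝ≥0) : ℂ) / 2 * ((∑ k, (L (Pi.single k 1)) ^ 2 : ℝ) : ℂ)) := by
  rw [charFunDual_pi]
  simp_rw [charFunDual_maxwell]
  rw [← Complex.exp_sum]
  push_cast
  rw [Finset.mul_sum]
  simp

theorem measurePreserving_collision (β : ℝ≥0) {a b : ι} (hab : a ≠ b) (θ : ℝ) :
    MeasurePreserving (fun x => collisionMap a b (x, θ))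
      (Measure.pi fun _ : ι => maxwell β) (Measure.pi fun _ : ι => maxwell β) := by
  let A : (ι → ℝ) →L[ℝ] (ι → ℝ) := LinearMap.toContinuousLinearMap
    { toFun := fun x => collisionMap a b (x, θ)
      map_add' := by
        intro x y; ext k; simp only [collisionMap, Pi.add_apply]; split_ifs <;> ring
      map_smul' := by
        intro c x; ext k
        simp only [collisionMap, Pi.smul_apply, smul_eq_mul, RingHom.id_apply]
        split_ifs <;> ring }
  have hA : (fun x => collisionMap a b (x, θ)) = A := rfl
  refine ⟨by rw [hA]; exact A.continuous.measurable, ?_⟩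
  rw [hA]
  refine Measure.ext_of_charFunDual (funext fun L => ?_)
  rw [charFunDual_map, charFunDual_pi_maxwell, charFunDual_pi_maxwell]
  congr 3
  have ha : A (Pi.single a 1) = Real.cos θ • Pi.single a 1 - Real.sin θ • Pi.single b 1 := by
    ext k
    change collisionMap a b (Pi.single a 1, θ) k = _
    by_cases h1 : k = a
    · subst h1; simp [collisionMap, hab, hab.symm]
    · by_cases h2 : k = b
      · subst h2; simp [collisionMap, h1]
      · simp [collisionMap, h1, h2]
  have hb : A (Pi.single b 1) = Real.sin θ • Pi.single a 1 + Real.cos θ • Pi.single b 1 := by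
    ext k
    change collisionMap a b (Pi.single b 1, θ) k = _
    by_cases h1 : k = a
    · subst h1; simp [collisionMap, hab]
    · by_cases h2 : k = b
      · subst h2; simp [collisionMap, h1, hab]
      · simp [collisionMap, h1, h2]
  have hk : ∀ k, k ≠ a → k ≠ b → A (Pi.single k 1) = Pi.single k 1 := by
    intro c hca hcb
    ext k
    change collisionMap a b (Pi.single c 1, θ) k = _
    by_cases h1 : k = a
    · subst h1; simp [collisionMap, hca.symm, hcb.symm]
    · by_cases h2 : k = b
      · subst h2; simp [collisionMap, h1, hca.symm, hcb.symm]
      · simp [collisionMap, h1, h2]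
  have hbm : b ∈ Finset.univ.erase a := by simp [hab.symm]
  rw [← Finset.add_sum_erase _ _ (Finset.mem_univ a), ← Finset.add_sum_erase _ _ hbm,
    ← Finset.add_sum_erase _ (fun k => L (Pi.single k 1) ^ 2) (Finset.mem_univ a),
    ← Finset.add_sum_erase _ (fun k => L (Pi.single k 1) ^ 2) hbm, ← add_assoc, ← add_assoc]
  congr 1
  · simp only [ContinuousLinearMap.comp_apply, ha, hb, map_sub, map_add, map_smul, smul_eq_mul]
    linear_combination (L (Pi.single a 1) ^ 2 + L (Pi.single b 1) ^ 2) * Real.sin_sq_add_cos_sq θ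
  · refine Finset.sum_congr rfl fun k hk' => ?_
    simp only [Finset.mem_erase, Finset.mem_univ, and_true] at hk'
    simp only [ContinuousLinearMap.comp_apply, hk k hk'.2 hk'.1]

theorem measurePreserving_thermostat (β : ℝ≥0) (a : ι) (θ : ℝ) :
    MeasurePreserving (fun p : (ι → ℝ) × ℝ => thermostatMap a (p.1, (p.2, θ)))
      ((Measure.pi fun _ : ι => maxwell β).prod (maxwell β))
      (Measure.pi fun _ : ι => maxwell β) := by
  let A : ((ι → ℝ) × ℝ) →L[ℝ] (ι → ℝ) := LinearMap.toContinuousLinearMap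
    { toFun := fun p => thermostatMap a (p.1, (p.2, θ))
      map_add' := by
        intro x y; ext k
        by_cases h : k = a
        · subst h; simp [thermostatMap]; ring
        · simp [thermostatMap, h]
      map_smul' := by
        intro c x; ext k
        by_cases h : k = a
        · subst h; simp [thermostatMap]; ring
        · simp [thermostatMap, h] }
  have hA : (fun p : (ι → ℝ) × ℝ => thermostatMap a (p.1, (p.2, θ))) = A := rfl
  refine ⟨by rw [hA]; exact A.continuous.measurable, ?_⟩
  rw [hA]
  refine Measure.ext_of_charFunDual (funext fun L => ?_)
  rw [charFunDual_map, charFunDual_prod, charFunDual_pi_maxwell, charFunDual_pi_maxwell,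
    charFunDual_maxwell, ← Complex.exp_add, ← mul_add]
  congr 2
  norm_cast
  have ha : A (Pi.single a 1, 0) = Real.cos θ • Pi.single a 1 := by
    ext k
    change thermostatMap a (Pi.single a 1, ((0 : ℝ), θ)) k = _
    by_cases h : k = a
    · subst h; simp [thermostatMap]
    · simp [thermostatMap, h]
  have hw : A (0, 1) = Real.sin θ • Pi.single a 1 := by
    ext k
    change thermostatMap a ((0 : ι → ℝ), ((1 : ℝ), θ)) k = _
    by_cases h : k = a
    · subst h; simp [thermostatMap]
    · simp [thermostatMap, h]
  have hk : ∀ k, k ≠ a → A (Pi.single k 1, 0) = Pi.single k 1 := by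
    intro c hc
    ext k
    change thermostatMap a (Pi.single c 1, ((0 : ℝ), θ)) k = _
    by_cases h : k = a
    · subst h; simp [thermostatMap, hc.symm]
    · simp [thermostatMap, h]
  rw [← Finset.add_sum_erase _ _ (Finset.mem_univ a),
    ← Finset.add_sum_erase _ (fun k => L (Pi.single k 1) ^ 2) (Finset.mem_univ a), add_right_comm]
  congr 1
  · simp only [ContinuousLinearMap.comp_apply, ContinuousLinearMap.inl_apply,
      ContinuousLinearMap.inr_apply, ha, hw, map_smul, smul_eq_mul]
    linear_combination (L (Pi.single a 1) ^ 2) * Real.sin_sq_add_cos_sq θ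
  · refine Finset.sum_congr rfl fun k hk' => ?_
    simp only [Finset.mem_erase, Finset.mem_univ, and_true] at hk'
    simp only [ContinuousLinearMap.comp_apply, ContinuousLinearMap.inl_apply, hk k hk']

end Maps

theorem measurePreserving_of_slices {X Y Θ : Type*} [MeasurableSpace X] [MeasurableSpace Y]
    [MeasurableSpace Θ] {m : Measure X} {m' : Measure Y} {ν : Measure Θ} [SFinite m]
    [IsProbabilityMeasure ν] {φ : X × Θ → Y} (hφ : Measurable φ)
    (h : ∀ θ, MeasurePreserving (fun x => φ (x, θ)) m m') :
    MeasurePreserving φ (m.prod ν) m' := by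
  refine ⟨hφ, Measure.ext fun s hs => ?_⟩
  rw [Measure.map_apply hφ hs, Measure.prod_apply_symm (hφ hs)]
  have : ∀ θ, m ((fun x => (x, θ)) ⁻¹' (φ ⁻¹' s)) = m' s := fun θ =>
    (h θ).measure_preimage hs.nullMeasurableSet
  simp [this]

theorem measurePreserving_collisionMap (β : ℝ≥0) {M N : ℕ} {a b : Fin M ⊕ Fin N} (hab : a ≠ b) :
    MeasurePreserving (collisionMap a b) ((maxwellian β M N).prod uniformAngle)
      (maxwellian β M N) :=
  measurePreserving_of_slices (measurable_collisionMap a b)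
    fun θ => measurePreserving_collision β hab θ

theorem measurePreserving_thermostatMap (β : ℝ≥0) {M N : ℕ} (a : Fin M ⊕ Fin N) :
    MeasurePreserving (thermostatMap a)
      ((maxwellian β M N).prod ((maxwell β).prod uniformAngle)) (maxwellian β M N) := by
  have h : MeasurePreserving
      (fun q : ((Velocities M N) × ℝ) × ℝ => thermostatMap a (q.1.1, (q.1.2, q.2)))
      (((maxwellian β M N).prod (maxwell β)).prod uniformAngle) (maxwellian β M N) :=
    measurePreserving_of_slices ((measurable_thermostatMap a).comp (by fun_prop))
      fun θ => measurePreserving_thermostat β a θ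
  exact h.comp (measurePreserving_prodAssoc _ _ _).symm

/-! ### The generators on `L²(Γ_{M+N})` -/

/-- The Hilbert space `L²(ℝ^{M+N}, Γ_{M+N})`. -/
abbrev L2 (β : ℝ≥0) (M N : ℕ) : Type := Lp ℝ 2 (maxwellian β M N)

section Generators

variable (β : ℝ≥0) (M N : ℕ)

/-- The collision operator `R_{a,b}` : averaging over the angle of a collision of the distinct
particles `a` and `b`. -/
def collisionOp {M N : ℕ} {a b : Fin M ⊕ Fin N} (hab : a ≠ b) : L2 β M N →L[ℝ] L2 β M N :=
  averageOp (measurePreserving_collisionMap β hab)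

/-- The thermostat operator `T_i` on the system particle `i`: averaging over the angle of a
collision with an external particle whose velocity is Maxwellian. -/
def thermostatOp {M : ℕ} (i : Fin M) : L2 β M N →L[ℝ] L2 β M N :=
  averageOp (measurePreserving_thermostatMap β (Sum.inl i : Fin M ⊕ Fin N))

/-- `𝓛_S = λ_S/(M-1) ∑_{i<j} (R^S_{i,j} - I)`. -/
def generatorS (lamS : ℝ) : L2 β M N →L[ℝ] L2 β M N :=
  (lamS / ((M : ℝ) - 1)) • ∑ p : {p : Fin M × Fin M // p.1 < p.2},
    (collisionOp β (M := M) (N := N) (Sum.inl_injective.ne p.2.ne) - 1)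

/-- `𝓛_R = λ_R/(N-1) ∑_{i<j} (R^R_{i,j} - I)`. -/
def generatorR (lamR : ℝ) : L2 β M N →L[ℝ] L2 β M N :=
  (lamR / ((N : ℝ) - 1)) • ∑ p : {p : Fin N × Fin N // p.1 < p.2},
    (collisionOp β (M := M) (N := N) (Sum.inr_injective.ne p.2.ne) - 1)

/-- `𝓛_I = μ/N ∑_{i≤M} ∑_{j≤N} (R^I_{i,j} - I)`. -/
def generatorI (mu : ℝ) : L2 β M N →L[ℝ] L2 β M N :=
  (mu / N) • ∑ i : Fin M, ∑ j : Fin N,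
    (collisionOp β (a := Sum.inl i) (b := Sum.inr j) Sum.inl_ne_inr - 1)

/-- `𝓛_T = μ ∑_{i≤M} (T_i - I)`. -/
def generatorT (mu : ℝ) : L2 β M N →L[ℝ] L2 β M N :=
  mu • ∑ i : Fin M, (thermostatOp β N i - 1)

/-- The generator `𝓛 = 𝓛_S + 𝓛_R + 𝓛_I` of the system coupled to the finite reservoir. -/
def generatorFR (lamS lamR mu : ℝ) : L2 β M N →L[ℝ] L2 β M N :=
  generatorS β M N lamS + generatorR β M N lamR + generatorI β M N mu

/-- The generator `𝓛_S + 𝓛_R + 𝓛_T` of the system coupled to the Maxwellian thermostat, acting on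
functions of all `M + N` velocities. -/
def generatorTh (lamS lamR mu : ℝ) : L2 β M N →L[ℝ] L2 β M N :=
  generatorS β M N lamS + generatorR β M N lamR + generatorT β M N mu

end Generators

end KacReservoir

end

/-! Let V be the functions of the system velocities, A the thermostat generator, B the
finite-reservoir one, E the average over all system velocities. Both generators kill E h₀, so h₀ may
be replaced by k = h₀ - E h₀, and Duhamel's formula expresses the difference as the integral over s
of e^{(t-s)B} (A - B) e^{sA} k. Three facts bound it.

Contraction: each collision operator is an orthogonal projection, so B is dissipative.

Gap: e^{sA} k stays in V ∩ ker E, where A ≤ -μ/2. For one particle, I - T_i ≥ (I - P_i)/2 on V, with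
P_i the average over v_i (`inner_thermostatOp_le`). Since the P_i commute, an Efron–Stein inequality
sums these bounds over i at no loss.

Closeness: on V, A - B = (μ/N) ∑_i ∑_j (T_i - R_ij). For fixed i the N vectors (T_i - R_ij) f are
orthogonal, like centred conditionally independent variables, each of norm at most ‖f‖/2. The sum
over j therefore has norm at most √N ‖f‖/2 instead of N ‖f‖/2, and ‖(A - B) f‖ ≤ (M/√N)(μ/2) ‖f‖
(`norm_generatorTh_sub_generatorFR_le`).

Integrating (μ/2) e^{-μs/2} gives 1 - e^{-μt/2}. The operator identities come from pointwise
identities between velocity maps; no eigenfunction expansion is used. -/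

noncomputable section

namespace KacReservoir

/-! ### Bounded operators on a real Hilbert space -/

section Hilbert

variable {H : Type*} [NormedAddCommGroup H] [InnerProductSpace ℝ H]

/-- An idempotent contraction of a Hilbert space is symmetric. -/
theorem inner_symm_of_idempotent_contraction {P : H →L[ℝ] H} (hP : ∀ x, P (P x) = P x)
    (hc : ∀ x, ‖P x‖ ≤ ‖x‖) (x y : H) : inner ℝ (P x) y = inner ℝ x (P y) := by
  have key : ∀ x y, inner ℝ (P x) (y - P y) = 0 := by
    intro x y
    set z := y - P y with hz
    have hPz : P z = 0 := by rw [hz, map_sub, hP, sub_self]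
    -- `P` sends `P x + t • z` to `P x`; contraction gives a quadratic in `t` with no constant term,
    -- nonnegative everywhere, so its linear coefficient vanishes.
    have h : ∀ t : ℝ, 0 ≤ ‖z‖ ^ 2 * (t * t) + 2 * inner ℝ (P x) z * t + 0 := by
      intro t
      have h1 := hc (P x + t • z)
      rw [map_add, map_smul, hPz, smul_zero, add_zero, hP] at h1
      have h2 := pow_le_pow_left₀ (norm_nonneg _) h1 2
      rw [norm_add_sq_real, inner_smul_right, norm_smul, mul_pow, Real.norm_eq_abs, sq_abs] at h2
      nlinarith
    have h3 := discrim_le_zero h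
    rw [discrim] at h3
    nlinarith [sq_nonneg (inner ℝ (P x) z)]
  have h1 := key x y
  have h2 := key y x
  rw [inner_sub_right, sub_eq_zero] at h1 h2
  rw [h1, real_inner_comm, ← h2, real_inner_comm]

theorem inner_self_of_idempotent_contraction {P : H →L[ℝ] H} (hP : ∀ x, P (P x) = P x)
    (hc : ∀ x, ‖P x‖ ≤ ‖x‖) (x : H) : inner ℝ (P x) x = ‖P x‖ ^ 2 := by
  rw [← real_inner_self_eq_norm_sq, ← inner_symm_of_idempotent_contraction hP hc, hP]

theorem norm_sq_eq_add_of_idempotent_contraction {P : H →L[ℝ] H} (hP : ∀ x, P (P x) = P x)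
    (hc : ∀ x, ‖P x‖ ≤ ‖x‖) (x : H) : ‖x‖ ^ 2 = ‖P x‖ ^ 2 + ‖x - P x‖ ^ 2 := by
  rw [norm_sub_sq_real, real_inner_comm, inner_self_of_idempotent_contraction hP hc]
  ring

theorem norm_list_prod_apply_le {ι : Type*} {P : ι → H →L[ℝ] H} (hc : ∀ a x, ‖P a x‖ ≤ ‖x‖)
    (l : List ι) (x : H) : ‖(l.map P).prod x‖ ≤ ‖x‖ := by
  induction l with
  | nil => simp
  | cons a l ih =>
    simp only [List.map_cons, List.prod_cons, mul_apply_eq_comp]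
    exact (hc a _).trans ih

/-- A tensorization inequality of Efron–Stein type for commuting idempotent contractions. -/
theorem list_prod_efron_stein {ι : Type*} {P : ι → H →L[ℝ] H}
    (hP : ∀ a x, P a (P a x) = P a x) (hc : ∀ a x, ‖P a x‖ ≤ ‖x‖)
    (hcomm : ∀ a b, Commute (P a) (P b)) (l : List ι) (x : H) :
    ‖x - (l.map P).prod x‖ ^ 2 ≤ (l.map fun a => ‖x - P a x‖ ^ 2).sum := by
  have hEc := norm_list_prod_apply_le hc
  have hcommE : ∀ (a : ι) (l : List ι), Commute (P a) (l.map P).prod := fun a l =>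
    Commute.list_prod_right _ _ fun T hT => by
      obtain ⟨b, -, rfl⟩ := List.mem_map.1 hT
      exact hcomm a b
  have hEP : ∀ (l : List ι) (x : H), (l.map P).prod ((l.map P).prod x) = (l.map P).prod x := by
    intro l
    induction l with
    | nil => simp
    | cons a l ih =>
      intro x
      simp only [List.map_cons, List.prod_cons, mul_apply_eq_comp]
      have := congrArg (fun T : H →L[ℝ] H => T ((l.map P).prod x)) (hcommE a l).eq
      simp only [mul_apply_eq_comp] at this
      rw [← this, hP, ih]
  induction l with
  | nil => simp
  | cons a l ih =>
    set E := (l.map P).prod with hE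
    simp only [List.map_cons, List.prod_cons, mul_apply_eq_comp, List.sum_cons, ← hE]
    have hswap : P a (E x) = E (P a x) := by
      have := congrArg (fun T : H →L[ℝ] H => T x) (hcommE a l).eq
      simpa only [mul_apply_eq_comp] using this
    -- Pythagoras for the projection `E`: `x - P a (E x)` splits into `E (x - P a x)` and `x - E x`.
    have horth := norm_sq_eq_add_of_idempotent_contraction (hEP l) (hEc l) (x - P a (E x))
    have h1 : E (x - P a (E x)) = E (x - P a x) := by
      rw [hswap, map_sub, map_sub, hE, hEP l]
    have h2 : x - P a (E x) - E (x - P a (E x)) = x - E x := by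
      rw [h1, hswap, map_sub]; abel
    rw [← hE, h2, h1] at horth
    rw [horth]
    gcongr
    exact hEc l _

theorem mem_of_exp_smul [CompleteSpace H] {A : H →L[ℝ] H} {V : Submodule ℝ H}
    (hV : IsClosed (V : Set H)) (hA : ∀ x ∈ V, A x ∈ V) {x : H} (hx : x ∈ V) (t : ℝ) :
    NormedSpace.exp (t • A) x ∈ V := by
  have hpow : ∀ n : ℕ, ((t • A) ^ n) x ∈ V := by
    intro n
    induction n with
    | zero => simpa using hx
    | succ n ih =>
      rw [pow_succ', mul_apply_eq_comp]
      exact V.smul_mem _ (hA _ ih)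
  have hs := (NormedSpace.exp_series_hasSum_exp' (𝕂 := ℝ) (t • A)).mapL
    (ContinuousLinearMap.apply ℝ H x)
  refine hV.mem_of_tendsto hs (Filter.Eventually.of_forall fun s => ?_)
  refine V.sum_mem fun n _ => ?_
  exact V.smul_mem _ (hpow n)

theorem hasDerivAt_exp_smul_apply [CompleteSpace H] (A : H →L[ℝ] H) (x : H) (t : ℝ) :
    HasDerivAt (fun s : ℝ => NormedSpace.exp (s • A) x) (A (NormedSpace.exp (t • A) x)) t :=
  (ContinuousLinearMap.apply ℝ H x).hasFDerivAt.comp_hasDerivAt t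
    (hasDerivAt_exp_smul_const' (𝕂 := ℝ) A t)

theorem exp_smul_apply_of_eq_zero [CompleteSpace H] {A : H →L[ℝ] H} {x : H} (hx : A x = 0) (t : ℝ) :
    NormedSpace.exp (t • A) x = x := by
  have hd : ∀ s : ℝ, HasDerivAt (fun s : ℝ => NormedSpace.exp (s • A) x) 0 s := fun s => by
    have h := (ContinuousLinearMap.apply ℝ H x).hasFDerivAt.comp_hasDerivAt s
      (hasDerivAt_exp_smul_const (𝕂 := ℝ) A s)
    refine h.congr_deriv ?_
    change NormedSpace.exp (s • A) (A x) = 0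
    rw [hx, map_zero]
  have h := is_const_of_deriv_eq_zero (fun s => (hd s).differentiableAt) (fun s => (hd s).deriv) t 0
  simpa using h

/-- Grönwall: `exp (2cs) ‖y s‖²` is nonincreasing. Dissipativity is asked only along the orbit of
`x`, so that a gap valid on an invariant subspace suffices. -/
theorem norm_exp_smul_apply_le [CompleteSpace H] {A : H →L[ℝ] H} {c : ℝ} {x : H}
    (hA : ∀ s : ℝ, 0 ≤ s → inner ℝ (A (NormedSpace.exp (s • A) x)) (NormedSpace.exp (s • A) x) ≤
      -c * ‖NormedSpace.exp (s • A) x‖ ^ 2) {t : ℝ} (ht : 0 ≤ t) :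
    ‖NormedSpace.exp (t • A) x‖ ≤ Real.exp (-c * t) * ‖x‖ := by
  set y : ℝ → H := fun s => NormedSpace.exp (s • A) x with hy
  have hd : ∀ s, HasDerivAt (fun s => Real.exp (2 * c * s) * ‖y s‖ ^ 2)
      (Real.exp (2 * c * s) * (2 * c) * ‖y s‖ ^ 2 +
        Real.exp (2 * c * s) * (2 * inner ℝ (y s) (A (y s)))) s := by
    intro s
    have h1 : HasDerivAt (fun s : ℝ => Real.exp (2 * c * s)) (Real.exp (2 * c * s) * (2 * c)) s := by
      simpa using ((hasDerivAt_id s).const_mul (2 * c)).exp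
    exact h1.mul (hasDerivAt_exp_smul_apply A x s).norm_sq
  have hanti : AntitoneOn (fun s => Real.exp (2 * c * s) * ‖y s‖ ^ 2) (Set.Ici 0) := by
    refine antitoneOn_of_deriv_nonpos (convex_Ici 0)
      (fun s _ => (hd s).continuousAt.continuousWithinAt)
      (fun s _ => (hd s).differentiableAt.differentiableWithinAt) fun s hs => ?_
    rw [interior_Ici] at hs
    rw [(hd s).deriv]
    have h1 := hA s (le_of_lt hs)
    rw [real_inner_comm] at h1
    have h2 := mul_le_mul_of_nonneg_left h1 (Real.exp_pos (2 * c * s)).le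
    change Real.exp (2 * c * s) * inner ℝ (y s) (A (y s)) ≤
      Real.exp (2 * c * s) * (-c * ‖y s‖ ^ 2) at h2
    linarith
  have h := hanti (Set.mem_Ici.2 le_rfl) (Set.mem_Ici.2 ht) ht
  have h0 : y 0 = x := by simp [hy]
  simp only [h0, mul_zero, Real.exp_zero, one_mul] at h
  refine le_of_sq_le_sq ?_ (by positivity)
  rw [mul_pow, ← Real.exp_nat_mul]
  have h3 : Real.exp (2 * c * t) * Real.exp (((2 : ℕ) : ℝ) * (-c * t)) = 1 := by
    rw [← Real.exp_add, Real.exp_eq_one_iff]; push_cast; ring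
  calc ‖y t‖ ^ 2 = (Real.exp (2 * c * t) * ‖y t‖ ^ 2) * Real.exp (((2 : ℕ) : ℝ) * (-c * t)) := by
        linear_combination (-‖y t‖ ^ 2) * h3
    _ ≤ ‖x‖ ^ 2 * Real.exp (((2 : ℕ) : ℝ) * (-c * t)) := by gcongr
    _ = _ := mul_comm _ _

/-- Comparison of two semigroups by Duhamel's formula: `exp (t B)` is a contraction semigroup and
the difference of the generators decays exponentially along the orbit of `A`. -/
theorem norm_exp_sub_exp_le [CompleteSpace H] {A B : H →L[ℝ] H} {x : H} {c K : ℝ}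
    (hB : ∀ s : ℝ, 0 ≤ s → ∀ y, ‖NormedSpace.exp (s • B) y‖ ≤ ‖y‖)
    (hAB : ∀ s : ℝ, 0 ≤ s → ‖(A - B) (NormedSpace.exp (s • A) x)‖ ≤ K * c * Real.exp (-c * s))
    {t : ℝ} (ht : 0 ≤ t) :
    ‖NormedSpace.exp (t • A) x - NormedSpace.exp (t • B) x‖ ≤ K * (1 - Real.exp (-c * t)) := by
  -- Duhamel interpolation, shifted so that `F 0 = 0`, while `F t` is the difference to be bounded.
  -- A mean value inequality against an explicit primitive replaces the integral.
  set F : ℝ → H := fun s => NormedSpace.exp ((t - s) • B) (NormedSpace.exp (s • A) x) -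
    NormedSpace.exp (t • B) x with hF
  have hd : ∀ s, HasDerivAt F
      (NormedSpace.exp ((t - s) • B) ((A - B) (NormedSpace.exp (s • A) x))) s := by
    intro s
    have h1 : HasDerivAt (fun s : ℝ => NormedSpace.exp ((t - s) • B))
        ((-1 : ℝ) • (NormedSpace.exp ((t - s) • B) * B)) s :=
      (hasDerivAt_exp_smul_const (𝕂 := ℝ) B (t - s)).scomp s
        (by simpa using (hasDerivAt_id s).const_sub t)
    have h2 := (h1.clm_apply (hasDerivAt_exp_smul_apply A x s)).sub_const
      (NormedSpace.exp (t • B) x)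
    refine h2.congr_deriv ?_
    change (-1 : ℝ) • NormedSpace.exp ((t - s) • B) (B (NormedSpace.exp (s • A) x)) + _ = _
    rw [sub_apply, map_sub, neg_one_smul, neg_add_eq_sub]
  have hbd : ∀ s, HasDerivAt (fun s => K * (1 - Real.exp (-c * s)))
      (K * c * Real.exp (-c * s)) s := by
    intro s
    have h1 : HasDerivAt (fun s : ℝ => Real.exp (-c * s)) (Real.exp (-c * s) * (-c)) s := by
      simpa using ((hasDerivAt_id s).const_mul (-c)).exp
    exact ((h1.const_sub 1).const_mul K).congr_deriv (by ring)
  have h := image_norm_le_of_norm_deriv_right_le_deriv_boundary (f := F) (a := 0) (b := t)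
    (fun s _ => (hd s).continuousAt.continuousWithinAt) (fun s _ => (hd s).hasDerivWithinAt)
    (by simp [hF]) hbd
    (fun s hs => (hB _ (sub_nonneg.2 hs.2.le) _).trans (hAB s hs.1)) (Set.right_mem_Icc.2 ht)
  simpa [hF] using h

end Hilbert

/-! ### Calculus of averaging operators -/

section AverageCalculus

variable {X Θ Θ' : Type*} [MeasurableSpace X] [MeasurableSpace Θ] [MeasurableSpace Θ']
  {m : Measure X} {ν : Measure Θ} {ν' : Measure Θ'} [IsProbabilityMeasure m]
  [IsProbabilityMeasure ν] [IsProbabilityMeasure ν'] {φ : X × Θ → X} {ψ : X × Θ' → X}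

theorem coeFn_averageOp (hφ : MeasurePreserving φ (m.prod ν) m) (f : Lp ℝ 2 m) :
    averageOp hφ f =ᵐ[m] average ν φ f :=
  MemLp.coeFn_toLp (memLp_average hφ (Lp.memLp f))

theorem norm_averageOp_apply_le (hφ : MeasurePreserving φ (m.prod ν) m) (f : Lp ℝ 2 m) :
    ‖averageOp hφ f‖ ≤ ‖f‖ := by
  rw [Lp.norm_def, Lp.norm_def, eLpNorm_congr_ae (coeFn_averageOp hφ f)]
  exact ENNReal.toReal_mono (Lp.eLpNorm_ne_top f) (eLpNorm_average_le hφ (Lp.memLp f))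

theorem averageOp_toLp (hφ : MeasurePreserving φ (m.prod ν) m) {f g : X → ℝ} (hf : MemLp f 2 m)
    (hg : MemLp g 2 m) (h : average ν φ f =ᵐ[m] g) : averageOp hφ (hf.toLp f) = hg.toLp g :=
  Lp.ext <| (coeFn_averageOp hφ _).trans <| (average_congr hφ hf.coeFn_toLp).trans <|
    h.trans hg.coeFn_toLp.symm

theorem averageOp_toLp_of_invariant (hφ : MeasurePreserving φ (m.prod ν) m) {f : X → ℝ}
    (hf : MemLp f 2 m) (h : ∀ x θ, f (φ (x, θ)) = f x) :
    averageOp hφ (hf.toLp f) = hf.toLp f :=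
  averageOp_toLp hφ hf hf (Filter.Eventually.of_forall fun x => by simp [average, h])

/-- An averaging operator fixes the range of another one whose averages are invariant. -/
theorem averageOp_apply_of_average_invariant (hφ : MeasurePreserving φ (m.prod ν) m)
    (hψ : MeasurePreserving ψ (m.prod ν') m)
    (h : ∀ (f : X → ℝ) x θ, average ν' ψ f (φ (x, θ)) = average ν' ψ f x) (f : Lp ℝ 2 m) :
    averageOp hφ (averageOp hψ f) = averageOp hψ f :=
  averageOp_toLp_of_invariant hφ (memLp_average hψ (Lp.memLp f)) (h f)

/-- The two-step map: first `φ`, then `ψ`, with independent parameters. -/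
def stepMap (φ : X × Θ → X) (ψ : X × Θ' → X) (p : X × (Θ × Θ')) : X :=
  ψ (φ (p.1, p.2.1), p.2.2)

theorem measurePreserving_stepMap (hφ : MeasurePreserving φ (m.prod ν) m)
    (hψ : MeasurePreserving ψ (m.prod ν') m) :
    MeasurePreserving (stepMap φ ψ) (m.prod (ν.prod ν')) m :=
  (hψ.comp (hφ.prod (MeasurePreserving.id ν'))).comp (measurePreserving_prodAssoc m ν ν').symm

/-- Fubini. The maps compose in the order opposite to the operators: the outer operator moves first.
-/
theorem averageOp_averageOp (hφ : MeasurePreserving φ (m.prod ν) m)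
    (hψ : MeasurePreserving ψ (m.prod ν') m) (f : Lp ℝ 2 m) :
    averageOp hφ (averageOp hψ f) = averageOp (measurePreserving_stepMap hφ hψ) f := by
  refine Lp.ext ((coeFn_averageOp hφ _).trans <| (average_congr hφ (coeFn_averageOp hψ f)).trans <|
    Filter.EventuallyEq.trans ?_ (coeFn_averageOp (measurePreserving_stepMap hφ hψ) f).symm)
  filter_upwards [ae_integrable_slice (measurePreserving_stepMap hφ hψ) (Lp.memLp f)] with x hx
  exact (integral_prod _ hx).symm

/-- Together with `averageOp_averageOp` this reduces operator identities to pointwise ones.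
Typically `e` swaps independent parameters or forgets those later overwritten. -/
theorem averageOp_eq_of_reparam (hφ : MeasurePreserving φ (m.prod ν) m)
    (hψ : MeasurePreserving ψ (m.prod ν') m) {e : Θ → Θ'} (he : MeasurePreserving e ν ν')
    (h : ∀ x θ, φ (x, θ) = ψ (x, e θ)) : averageOp hφ = averageOp hψ := by
  ext1 f
  refine Lp.ext ((coeFn_averageOp hφ f).trans <|
    Filter.EventuallyEq.trans ?_ (coeFn_averageOp hψ f).symm)
  filter_upwards [ae_integrable_slice hψ (Lp.memLp f)] with x hx
  simp only [average, h]
  rw [← he.map_eq, integral_map he.measurable.aemeasurable]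
  rw [he.map_eq]
  exact hx.aestronglyMeasurable

end AverageCalculus

/-! ### Refreshing a velocity, and relations between the operators -/

section Relations

/-- Replace the velocity of the particle `a` by a new one. -/
def refreshMap {ι : Type*} [DecidableEq ι] (a : ι) (p : (ι → ℝ) × ℝ) : ι → ℝ :=
  Function.update p.1 a p.2

variable (β : ℝ≥0) {M N : ℕ}

theorem measurePreserving_refreshMap (a : Fin M ⊕ Fin N) :
    MeasurePreserving (refreshMap a) ((maxwellian β M N).prod (maxwell β)) (maxwellian β M N) := by
  -- At angle π/2 a thermostat collision replaces the velocity altogether.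
  have h := measurePreserving_thermostat β a (Real.pi / 2)
  have h' : (fun p : Velocities M N × ℝ => thermostatMap a (p.1, (p.2, Real.pi / 2))) =
      refreshMap a := by
    ext p; simp [thermostatMap, refreshMap]
  rwa [h'] at h

/-- The conditional expectation given the velocities of the particles other than `a`. -/
def refreshOp (a : Fin M ⊕ Fin N) : L2 β M N →L[ℝ] L2 β M N :=
  averageOp (measurePreserving_refreshMap β a)

/-- A fixed rotation is viewed as an average over a one-point parameter space, so the same calculus
applies. -/
theorem measurePreserving_collisionMap_const {a b : Fin M ⊕ Fin N} (hab : a ≠ b) (θ : ℝ) :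
    MeasurePreserving (fun p : Velocities M N × Unit => collisionMap a b (p.1, θ))
      ((maxwellian β M N).prod (Measure.dirac ())) (maxwellian β M N) :=
  measurePreserving_of_slices ((measurable_collisionMap a b).comp (by fun_prop))
    fun _ => measurePreserving_collision β hab θ

/-- Composition with the rotation by the angle `θ` in the plane of the velocities of `a`, `b`. -/
def rotateOp {a b : Fin M ⊕ Fin N} (hab : a ≠ b) (θ : ℝ) : L2 β M N →L[ℝ] L2 β M N :=
  averageOp (measurePreserving_collisionMap_const β hab θ)

theorem norm_refreshOp_apply_le (a : Fin M ⊕ Fin N) (f : L2 β M N) : ‖refreshOp β a f‖ ≤ ‖f‖ :=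
  norm_averageOp_apply_le _ f

theorem norm_collisionOp_apply_le {a b : Fin M ⊕ Fin N} (hab : a ≠ b) (f : L2 β M N) :
    ‖collisionOp β hab f‖ ≤ ‖f‖ :=
  norm_averageOp_apply_le _ f

theorem refreshOp_refreshOp_self (a : Fin M ⊕ Fin N) (f : L2 β M N) :
    refreshOp β a (refreshOp β a f) = refreshOp β a f := by
  rw [refreshOp, averageOp_averageOp]
  refine congrArg (fun T : L2 β M N →L[ℝ] L2 β M N => T f)
    (averageOp_eq_of_reparam _ _ measurePreserving_snd fun x u => ?_)
  simp [stepMap, refreshMap]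

theorem refreshOp_comm (a b : Fin M ⊕ Fin N) (f : L2 β M N) :
    refreshOp β a (refreshOp β b f) = refreshOp β b (refreshOp β a f) := by
  by_cases hab : a = b
  · rw [hab]
  rw [refreshOp, refreshOp, averageOp_averageOp, averageOp_averageOp]
  refine congrArg (fun T : L2 β M N →L[ℝ] L2 β M N => T f)
    (averageOp_eq_of_reparam _ _ Measure.measurePreserving_swap fun x u => ?_)
  simp only [stepMap, refreshMap, Prod.fst_swap, Prod.snd_swap]
  exact Function.update_comm hab _ _ _

theorem refreshOp_collisionOp_comm {a b c : Fin M ⊕ Fin N} (hab : a ≠ b) (hca : c ≠ a)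
    (hcb : c ≠ b) (f : L2 β M N) :
    refreshOp β c (collisionOp β hab f) = collisionOp β hab (refreshOp β c f) := by
  rw [refreshOp, collisionOp, averageOp_averageOp, averageOp_averageOp]
  refine congrArg (fun T : L2 β M N →L[ℝ] L2 β M N => T f)
    (averageOp_eq_of_reparam _ _ Measure.measurePreserving_swap fun x u => ?_)
  ext k
  simp only [stepMap, refreshMap, collisionMap, Prod.fst_swap, Prod.snd_swap,
    Function.update_apply, hca.symm, hcb.symm, if_false]
  split_ifs <;> simp_all

theorem refreshOp_thermostatOp_comm {i : Fin M} {c : Fin M ⊕ Fin N} (hc : c ≠ Sum.inl i)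
    (f : L2 β M N) :
    refreshOp β c (thermostatOp β N i f) = thermostatOp β N i (refreshOp β c f) := by
  rw [refreshOp, thermostatOp, averageOp_averageOp, averageOp_averageOp]
  refine congrArg (fun T : L2 β M N →L[ℝ] L2 β M N => T f)
    (averageOp_eq_of_reparam _ _ Measure.measurePreserving_swap fun x u => ?_)
  simp only [stepMap, refreshMap, thermostatMap, Prod.fst_swap, Prod.snd_swap,
    Function.update_of_ne hc.symm]
  exact Function.update_comm hc _ _ _

/-- The collision happens first, and both velocities it changed are then overwritten. -/
theorem collisionOp_refreshOp_refreshOp {a b : Fin M ⊕ Fin N} (hab : a ≠ b) (f : L2 β M N) :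
    collisionOp β hab (refreshOp β a (refreshOp β b f)) = refreshOp β a (refreshOp β b f) := by
  rw [refreshOp, refreshOp, collisionOp,
    averageOp_averageOp (measurePreserving_refreshMap β a), averageOp_averageOp]
  refine congrArg (fun T : L2 β M N →L[ℝ] L2 β M N => T f)
    (averageOp_eq_of_reparam _ _ measurePreserving_snd fun x u => ?_)
  ext k
  simp only [stepMap, refreshMap, collisionMap, Function.update_apply]
  split_ifs <;> simp_all

theorem thermostatOp_refreshOp_self (i : Fin M) (f : L2 β M N) :
    thermostatOp β N i (refreshOp β (Sum.inl i) f) = refreshOp β (Sum.inl i) f := by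
  rw [refreshOp, thermostatOp, averageOp_averageOp]
  refine congrArg (fun T : L2 β M N →L[ℝ] L2 β M N => T f)
    (averageOp_eq_of_reparam _ _ measurePreserving_snd fun x u => ?_)
  simp [stepMap, refreshMap, thermostatMap]

/-- A thermostat collision is a collision with a reservoir particle just refreshed; the last refresh
erases that particle's outgoing velocity, where the two maps would differ. -/
theorem thermostatOp_refreshOp (i : Fin M) (j : Fin N) (f : L2 β M N) :
    thermostatOp β N i (refreshOp β (Sum.inr j) f) =
      refreshOp β (Sum.inr j) (collisionOp β (a := Sum.inl i) (b := Sum.inr j) Sum.inl_ne_inr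
        (refreshOp β (Sum.inr j) f)) := by
  rw [refreshOp, thermostatOp, collisionOp, averageOp_averageOp, averageOp_averageOp,
    averageOp_averageOp]
  refine congrArg (fun T : L2 β M N →L[ℝ] L2 β M N => T f)
    (averageOp_eq_of_reparam _ _ (MeasurePreserving.id _) fun x u => ?_)
  ext k
  simp only [stepMap, refreshMap, thermostatMap, collisionMap, Function.update_apply, id]
  split_ifs <;> simp_all

theorem collisionMap_collisionMap {ι : Type*} [DecidableEq ι] {a b : ι} (hab : a ≠ b) (x : ι → ℝ)
    (θ α : ℝ) : collisionMap a b (collisionMap a b (x, α), θ) = collisionMap a b (x, θ + α) := by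
  ext k
  simp only [collisionMap, hab.symm, if_true, if_false, Real.cos_add, Real.sin_add]
  split_ifs <;> ring

theorem integral_uniformAngle (g : ℝ → ℝ) :
    ∫ θ, g θ ∂uniformAngle = (2 * Real.pi)⁻¹ * ∫ θ in (0 : ℝ)..2 * Real.pi, g θ := by
  rw [uniformAngle, ProbabilityTheory.cond, integral_smul_measure,
    intervalIntegral.integral_of_le Real.two_pi_pos.le]
  simp [Real.pi_pos.le]

/-- Rotations add, so the prior collision shifts the angle in an integral over a full period. Hence
collision operators are idempotent and their ranges rotation invariant. -/
theorem average_collisionMap_collisionMap {ι : Type*} [DecidableEq ι] {a b : ι} (hab : a ≠ b)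
    (f : (ι → ℝ) → ℝ) (x : ι → ℝ) (α : ℝ) :
    average uniformAngle (collisionMap a b) f (collisionMap a b (x, α)) =
      average uniformAngle (collisionMap a b) f x := by
  have hper : Function.Periodic (fun θ => f (collisionMap a b (x, θ))) (2 * Real.pi) := fun θ => by
    have h : collisionMap a b (x, θ + 2 * Real.pi) = collisionMap a b (x, θ) := by
      ext k
      simp only [collisionMap, Real.cos_add_two_pi, Real.sin_add_two_pi]
    simp only [h]
  simp only [average, collisionMap_collisionMap hab, integral_uniformAngle]
  rw [intervalIntegral.integral_comp_add_right fun θ => f (collisionMap a b (x, θ)), zero_add,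
    add_comm (2 * Real.pi), hper.intervalIntegral_add_eq α 0, zero_add]

theorem collisionOp_collisionOp_self {a b : Fin M ⊕ Fin N} (hab : a ≠ b) (f : L2 β M N) :
    collisionOp β hab (collisionOp β hab f) = collisionOp β hab f :=
  averageOp_apply_of_average_invariant _ _
    (fun g x θ => average_collisionMap_collisionMap hab g x θ) f

theorem rotateOp_collisionOp {a b : Fin M ⊕ Fin N} (hab : a ≠ b) (θ : ℝ) (f : L2 β M N) :
    rotateOp β hab θ (collisionOp β hab f) = collisionOp β hab f :=
  averageOp_apply_of_average_invariant _ _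
    (fun g x _ => average_collisionMap_collisionMap hab g x θ) f

/-- A quarter turn carries the velocity of `b` to `a`; overwriting `a` afterwards is overwriting `b`
beforehand. -/
theorem rotateOp_refreshOp {a b : Fin M ⊕ Fin N} (hab : a ≠ b) (f : L2 β M N) :
    rotateOp β hab (Real.pi / 2) (refreshOp β a f) =
      refreshOp β b (rotateOp β hab (Real.pi / 2) f) := by
  rw [refreshOp, rotateOp, refreshOp, averageOp_averageOp, averageOp_averageOp]
  refine congrArg (fun T : L2 β M N →L[ℝ] L2 β M N => T f)
    (averageOp_eq_of_reparam _ _ Measure.measurePreserving_swap fun x u => ?_)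
  ext k
  simp only [stepMap, refreshMap, collisionMap, Function.update_apply, Real.cos_pi_div_two,
    Real.sin_pi_div_two, Prod.fst_swap]
  split_ifs <;> simp_all

end Relations

/-! ### Estimates for functions of the system velocities -/

section Estimates

variable (β : ℝ≥0) {M N : ℕ}

theorem inner_refreshOp_comm (a : Fin M ⊕ Fin N) (f g : L2 β M N) :
    inner ℝ (refreshOp β a f) g = inner ℝ f (refreshOp β a g) :=
  inner_symm_of_idempotent_contraction (refreshOp_refreshOp_self β a)
    (norm_refreshOp_apply_le β a) f g

theorem inner_refreshOp_self (a : Fin M ⊕ Fin N) (f : L2 β M N) :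
    inner ℝ (refreshOp β a f) f = ‖refreshOp β a f‖ ^ 2 :=
  inner_self_of_idempotent_contraction (refreshOp_refreshOp_self β a)
    (norm_refreshOp_apply_le β a) f

theorem inner_collisionOp_comm {a b : Fin M ⊕ Fin N} (hab : a ≠ b) (f g : L2 β M N) :
    inner ℝ (collisionOp β hab f) g = inner ℝ f (collisionOp β hab g) :=
  inner_symm_of_idempotent_contraction (collisionOp_collisionOp_self β hab)
    (norm_collisionOp_apply_le β hab) f g

theorem inner_collisionOp_self {a b : Fin M ⊕ Fin N} (hab : a ≠ b) (f : L2 β M N) :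
    inner ℝ (collisionOp β hab f) f = ‖collisionOp β hab f‖ ^ 2 :=
  inner_self_of_idempotent_contraction (collisionOp_collisionOp_self β hab)
    (norm_collisionOp_apply_le β hab) f

/-- The adjoint of `collisionOp_refreshOp_refreshOp`, since the operators are symmetric. -/
theorem refreshOp_refreshOp_collisionOp {a b : Fin M ⊕ Fin N} (hab : a ≠ b) (f : L2 β M N) :
    refreshOp β a (refreshOp β b (collisionOp β hab f)) = refreshOp β a (refreshOp β b f) := by
  refine ext_inner_right ℝ fun g => ?_
  rw [inner_refreshOp_comm, inner_refreshOp_comm, inner_collisionOp_comm, inner_refreshOp_comm,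
    inner_refreshOp_comm, refreshOp_comm β b a, collisionOp_refreshOp_refreshOp]

theorem collisionOp_apply_of_fixed {a b : Fin M ⊕ Fin N} (hab : a ≠ b) {f : L2 β M N}
    (ha : refreshOp β a f = f) (hb : refreshOp β b f = f) : collisionOp β hab f = f := by
  have h := collisionOp_refreshOp_refreshOp β hab f
  rwa [hb, ha] at h

/-- The collision operator of a system and a reservoir particle. -/
abbrev interactionOp (i : Fin M) (j : Fin N) : L2 β M N →L[ℝ] L2 β M N :=
  collisionOp β (a := Sum.inl i) (b := Sum.inr j) Sum.inl_ne_inr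

variable {β}

section Fixed

variable {h : L2 β M N} {i : Fin M} {j : Fin N}

theorem thermostatOp_apply_eq (hj : refreshOp β (Sum.inr j) h = h) :
    thermostatOp β N i h = refreshOp β (Sum.inr j) (interactionOp β i j h) := by
  have := thermostatOp_refreshOp β i j h
  rwa [hj] at this

theorem inner_thermostatOp_self (hj : refreshOp β (Sum.inr j) h = h) :
    inner ℝ (thermostatOp β N i h) h = ‖interactionOp β i j h‖ ^ 2 := by
  rw [thermostatOp_apply_eq hj, inner_refreshOp_comm, hj, inner_collisionOp_self]

theorem inner_interactionOp_thermostatOp (hj : refreshOp β (Sum.inr j) h = h) :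
    inner ℝ (interactionOp β i j h) (thermostatOp β N i h) = ‖thermostatOp β N i h‖ ^ 2 := by
  rw [thermostatOp_apply_eq hj, real_inner_comm, inner_refreshOp_self]

theorem refreshOp_thermostatOp_self (hj : refreshOp β (Sum.inr j) h = h) :
    refreshOp β (Sum.inl i) (thermostatOp β N i h) = refreshOp β (Sum.inl i) h := by
  rw [thermostatOp_apply_eq hj, refreshOp_refreshOp_collisionOp, hj]

/-- The first factor does not involve the velocity of `k`, so the second may be averaged over it and
becomes the thermostat operator. -/
theorem inner_interactionOp_interactionOp {k : Fin N} (hjk : j ≠ k)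
    (hj : refreshOp β (Sum.inr j) h = h) (hk : refreshOp β (Sum.inr k) h = h) :
    inner ℝ (interactionOp β i j h) (interactionOp β i k h) = ‖thermostatOp β N i h‖ ^ 2 := by
  have h1 : refreshOp β (Sum.inr k) (interactionOp β i j h) = interactionOp β i j h := by
    rw [refreshOp_collisionOp_comm β _ Sum.inr_ne_inl (Sum.inr_injective.ne hjk.symm), hk]
  rw [← h1, inner_refreshOp_comm, ← thermostatOp_apply_eq hk, inner_interactionOp_thermostatOp hj]

/-- On functions of the system velocities with zero mean in the velocity of the particle `i`, the
thermostat operator is bounded by `1/2`. -/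
theorem inner_thermostatOp_le_half (hj : refreshOp β (Sum.inr j) h = h)
    (hi : refreshOp β (Sum.inl i) h = 0) :
    inner ℝ (thermostatOp β N i h) h ≤ 1 / 2 * ‖h‖ ^ 2 := by
  set g := interactionOp β i j h with hg
  set p := refreshOp β (Sum.inl i) g with hp
  have hT : thermostatOp β N i h = refreshOp β (Sum.inr j) g := thermostatOp_apply_eq hj
  -- The quarter turn fixes `g` and exchanges its averages over the two particles.
  have hle : ‖thermostatOp β N i h‖ ≤ ‖p‖ := by
    rw [hT, hg, ← rotateOp_collisionOp β _ (Real.pi / 2), ← rotateOp_refreshOp]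
    exact norm_averageOp_apply_le _ _
  have horth : inner ℝ (thermostatOp β N i h) p = 0 := by
    rw [hp, real_inner_comm, inner_refreshOp_comm, refreshOp_thermostatOp_self hj, hi,
      inner_zero_right]
  have hTg : inner ℝ g (thermostatOp β N i h) = ‖thermostatOp β N i h‖ ^ 2 :=
    inner_interactionOp_thermostatOp hj
  have hpg : inner ℝ g p = ‖p‖ ^ 2 := by rw [real_inner_comm, hp, inner_refreshOp_self]
  -- Bessel for the orthogonal projections `T h` and `p` of `g`: with `hle`, `2 ‖T h‖² ≤ ‖g‖²`.
  have hnn : 0 ≤ ‖g - (thermostatOp β N i h + p)‖ ^ 2 := sq_nonneg _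
  rw [norm_sub_sq_real, norm_add_sq_real, inner_add_right, hTg, hpg, horth] at hnn
  have hsq : ‖thermostatOp β N i h‖ ^ 2 ≤ ‖p‖ ^ 2 := by gcongr
  have hgs : inner ℝ (thermostatOp β N i h) h = ‖g‖ ^ 2 := inner_thermostatOp_self hj
  -- As `⟨T h, h⟩ = ‖g‖²`, this reads `4 ‖g‖² ≤ ‖h‖² + 4 ‖T h‖²`, hence `2 ‖g‖² ≤ ‖h‖²`.
  have hsub : 0 ≤ ‖h - (2 : ℝ) • thermostatOp β N i h‖ ^ 2 := sq_nonneg _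
  rw [norm_sub_sq_real, inner_smul_right, real_inner_comm, norm_smul, mul_pow, hgs] at hsub
  norm_num at hsub
  rw [hgs]
  nlinarith

/-- The mean `q` over particle `i` is fixed by `T` and orthogonal to the rest; the centred part
obeys `inner_thermostatOp_le_half`. -/
theorem inner_thermostatOp_le (hj : refreshOp β (Sum.inr j) h = h) :
    inner ℝ (thermostatOp β N i h) h ≤
      ‖h‖ ^ 2 - 1 / 2 * ‖h - refreshOp β (Sum.inl i) h‖ ^ 2 := by
  set q := refreshOp β (Sum.inl i) h with hq
  have hqj : refreshOp β (Sum.inr j) q = q := by rw [hq, refreshOp_comm, hj]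
  have hj' : refreshOp β (Sum.inr j) (h - q) = h - q := by rw [map_sub, hj, hqj]
  have hi' : refreshOp β (Sum.inl i) (h - q) = 0 := by
    rw [map_sub, hq, refreshOp_refreshOp_self, sub_self]
  have hTq : thermostatOp β N i q = q := thermostatOp_refreshOp_self β i h
  have hmain := inner_thermostatOp_le_half (i := i) hj' hi'
  have hsq := norm_sq_eq_add_of_idempotent_contraction (refreshOp_refreshOp_self β (Sum.inl i))
    (norm_refreshOp_apply_le β (Sum.inl i)) h
  rw [← hq] at hsq
  have hqh : inner ℝ q h = ‖q‖ ^ 2 := inner_refreshOp_self β (Sum.inl i) h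
  have hTh : inner ℝ (thermostatOp β N i h) q = ‖q‖ ^ 2 := by
    rw [hq, ← inner_refreshOp_comm, refreshOp_thermostatOp_self hj, ← hq, hqh]
  rw [map_sub, hTq, inner_sub_left, inner_sub_right, inner_sub_right, hTh, hqh,
    real_inner_self_eq_norm_sq] at hmain
  linarith

end Fixed

/-- The functions of the system velocities, as those which are not changed by refreshing the
velocity of a reservoir particle. -/
def systemSubspace (β : ℝ≥0) (M N : ℕ) : Submodule ℝ (L2 β M N) where
  carrier := {h | ∀ j : Fin N, refreshOp β (Sum.inr j) h = h}
  add_mem' := fun hf hg j => by rw [map_add, hf j, hg j]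
  zero_mem' := fun j => map_zero _
  smul_mem' := fun c f hf j => by rw [map_smul, hf j]

theorem isClosed_systemSubspace : IsClosed (systemSubspace β M N : Set (L2 β M N)) := by
  have : (systemSubspace β M N : Set (L2 β M N)) = ⋂ j : Fin N,
      {h | refreshOp β (Sum.inr j) h = h} := by
    ext h; simp [systemSubspace]
  rw [this]
  exact isClosed_iInter fun j =>
    isClosed_eq (refreshOp β (Sum.inr j)).continuous continuous_id

/-- The summands are pairwise orthogonal with common squared norm `d`, which yields √N rather than
N. -/
theorem norm_sum_thermostatOp_sub_interactionOp_le {h : L2 β M N}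
    (hh : h ∈ systemSubspace β M N) (i : Fin M) :
    ‖∑ j, (thermostatOp β N i h - interactionOp β i j h)‖ ≤ Real.sqrt N / 2 * ‖h‖ := by
  set d := inner ℝ (thermostatOp β N i h) h - ‖thermostatOp β N i h‖ ^ 2 with hd
  have hin : ∀ j k : Fin N, inner ℝ (thermostatOp β N i h - interactionOp β i j h)
      (thermostatOp β N i h - interactionOp β i k h) = if j = k then d else 0 := by
    intro j k
    rw [inner_sub_left, inner_sub_right, inner_sub_right, inner_interactionOp_thermostatOp (hh j),
      real_inner_comm (interactionOp β i k h), inner_interactionOp_thermostatOp (hh k), real_inner_self_eq_norm_sq]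
    split_ifs with hjk
    · subst hjk
      rw [real_inner_self_eq_norm_sq, hd, inner_thermostatOp_self (hh j)]
      ring
    · rw [inner_interactionOp_interactionOp hjk (hh j) (hh k)]
      ring
  have hsq : ‖∑ j, (thermostatOp β N i h - interactionOp β i j h)‖ ^ 2 = N * d := by
    rw [← real_inner_self_eq_norm_sq, sum_inner]
    simp only [inner_sum, hin]
    simp
  -- This is x - x² ≤ 1/4 in operator form.
  have hd4 : d ≤ 1 / 4 * ‖h‖ ^ 2 := by
    have hnn : 0 ≤ ‖h - (2 : ℝ) • thermostatOp β N i h‖ ^ 2 := sq_nonneg _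
    rw [norm_sub_sq_real, inner_smul_right, real_inner_comm, norm_smul, mul_pow] at hnn
    norm_num at hnn
    rw [hd]
    linarith
  refine le_of_sq_le_sq ?_ (by positivity)
  rw [hsq, mul_pow, div_pow, Real.sq_sqrt (Nat.cast_nonneg N)]
  have := mul_le_mul_of_nonneg_left hd4 (Nat.cast_nonneg (α := ℝ) N)
  linarith

/-! ### Averaging over the system velocities -/

/-- The conditional expectation given the velocities of the reservoir particles. -/
def systemMean (β : ℝ≥0) (M N : ℕ) : L2 β M N →L[ℝ] L2 β M N :=
  ((List.finRange M).map fun i => refreshOp β (Sum.inl i : Fin M ⊕ Fin N)).prod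

theorem commute_refreshOp (a b : Fin M ⊕ Fin N) : Commute (refreshOp β a) (refreshOp β b) :=
  ContinuousLinearMap.ext fun f => refreshOp_comm β a b f

theorem refreshOp_systemMean_comm (a : Fin M ⊕ Fin N) (f : L2 β M N) :
    refreshOp β a (systemMean β M N f) = systemMean β M N (refreshOp β a f) := by
  have h : Commute (refreshOp β a) (systemMean β M N) :=
    Commute.list_prod_right _ _ fun T hT => by
      obtain ⟨i, -, rfl⟩ := List.mem_map.1 hT
      exact commute_refreshOp a _
  exact congrArg (fun T : L2 β M N →L[ℝ] L2 β M N => T f) h.eq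

theorem refreshOp_systemMean (i : Fin M) (f : L2 β M N) :
    refreshOp β (Sum.inl i) (systemMean β M N f) = systemMean β M N f := by
  have h : ∀ l : List (Fin M), i ∈ l →
      refreshOp β (Sum.inl i : Fin M ⊕ Fin N) *
        (l.map fun i => refreshOp β (Sum.inl i : Fin M ⊕ Fin N)).prod =
        (l.map fun i => refreshOp β (Sum.inl i : Fin M ⊕ Fin N)).prod := by
    intro l
    induction l with
    | nil => simp
    | cons k l ih =>
      intro hi
      rw [List.map_cons, List.prod_cons]
      rcases List.mem_cons.1 hi with rfl | hi
      · rw [← mul_assoc]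
        congr 1
        exact ContinuousLinearMap.ext fun f => refreshOp_refreshOp_self β _ f
      · rw [← mul_assoc, (commute_refreshOp _ _).eq, mul_assoc, ih hi]
  exact congrArg (fun T : L2 β M N →L[ℝ] L2 β M N => T f) (h _ (List.mem_finRange i))

theorem systemMean_eq_of_fixed {f : L2 β M N}
    (hf : ∀ i : Fin M, refreshOp β (Sum.inl i) f = f) : systemMean β M N f = f := by
  have h : ∀ l : List (Fin M),
      (l.map fun i => refreshOp β (Sum.inl i : Fin M ⊕ Fin N)).prod f = f := by
    intro l
    induction l with
    | nil => simp
    | cons k l ih => rw [List.map_cons, List.prod_cons, mul_apply_eq_comp, ih, hf]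
  exact h _

theorem norm_sub_systemMean_le (f : L2 β M N) : ‖f - systemMean β M N f‖ ≤ ‖f‖ := by
  have hP : ∀ f, systemMean β M N (systemMean β M N f) = systemMean β M N f := fun f =>
    systemMean_eq_of_fixed fun i => refreshOp_systemMean i f
  have hc : ∀ f, ‖systemMean β M N f‖ ≤ ‖f‖ := fun f =>
    norm_list_prod_apply_le (fun i => norm_refreshOp_apply_le β _) _ f
  refine le_of_sq_le_sq ?_ (norm_nonneg _)
  rw [norm_sq_eq_add_of_idempotent_contraction hP hc f]
  linarith [sq_nonneg ‖systemMean β M N f‖]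

theorem norm_sub_systemMean_sq_le (f : L2 β M N) :
    ‖f - systemMean β M N f‖ ^ 2 ≤ ∑ i : Fin M, ‖f - refreshOp β (Sum.inl i) f‖ ^ 2 := by
  have h := list_prod_efron_stein (P := fun i : Fin M => refreshOp β (Sum.inl i : Fin M ⊕ Fin N))
    (fun i => refreshOp_refreshOp_self β _) (fun i => norm_refreshOp_apply_le β _)
    (fun i k => commute_refreshOp _ _) (List.finRange M) f
  rwa [← List.sum_toFinset _ (List.nodup_finRange M), List.toFinset_finRange] at h

end Estimates

/-! ### Dissipativity of the generators -/

section Dissipativity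

variable {β : ℝ≥0} {M N : ℕ} {lamS lamR mu : ℝ}

theorem inner_collisionOp_sub_one_nonpos {a b : Fin M ⊕ Fin N} (hab : a ≠ b) (f : L2 β M N) :
    inner ℝ ((collisionOp β hab - 1) f) f ≤ 0 := by
  rw [sub_apply, one_apply_eq_self, inner_sub_left, inner_collisionOp_self,
    real_inner_self_eq_norm_sq, sub_nonpos]
  exact pow_le_pow_left₀ (norm_nonneg _) (norm_collisionOp_apply_le β hab f) 2

theorem inner_generatorS_nonpos (hlamS : 0 ≤ lamS) (f : L2 β M N) :
    inner ℝ (generatorS β M N lamS f) f ≤ 0 := by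
  -- For `M = 0` the prefactor is `-lamS`, of the wrong sign, but the sum is empty; for `M = 1`
  -- division by zero gives 0.
  rcases M.eq_zero_or_pos with rfl | hM
  · simp [generatorS]
  rw [generatorS, smul_apply, sum_apply, inner_smul_left, sum_inner]
  have h1 : (1 : ℝ) ≤ M := by exact_mod_cast hM
  exact mul_nonpos_of_nonneg_of_nonpos (div_nonneg hlamS (sub_nonneg.2 h1))
    (Finset.sum_nonpos fun p _ => inner_collisionOp_sub_one_nonpos _ f)

theorem inner_generatorR_nonpos (hlamR : 0 ≤ lamR) (f : L2 β M N) :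
    inner ℝ (generatorR β M N lamR f) f ≤ 0 := by
  rcases N.eq_zero_or_pos with rfl | hN
  · simp [generatorR]
  rw [generatorR, smul_apply, sum_apply, inner_smul_left, sum_inner]
  have h1 : (1 : ℝ) ≤ N := by exact_mod_cast hN
  exact mul_nonpos_of_nonneg_of_nonpos (div_nonneg hlamR (sub_nonneg.2 h1))
    (Finset.sum_nonpos fun p _ => inner_collisionOp_sub_one_nonpos _ f)

theorem generatorI_apply (f : L2 β M N) :
    generatorI β M N mu f = (mu / N) • ∑ i, ∑ j, (interactionOp β i j f - f) := by
  simp [generatorI, interactionOp, sum_apply, sub_apply, smul_apply]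

theorem generatorT_apply (f : L2 β M N) :
    generatorT β M N mu f = mu • ∑ i, (thermostatOp β N i f - f) := by
  simp [generatorT, sum_apply, sub_apply, smul_apply]

theorem inner_generatorFR_nonpos (hlamS : 0 ≤ lamS) (hlamR : 0 ≤ lamR) (hmu : 0 ≤ mu)
    (f : L2 β M N) : inner ℝ (generatorFR β M N lamS lamR mu f) f ≤ 0 := by
  have hI : inner ℝ (generatorI β M N mu f) f ≤ 0 := by
    rw [generatorI_apply, inner_smul_left, sum_inner]
    refine mul_nonpos_of_nonneg_of_nonpos (div_nonneg hmu (Nat.cast_nonneg N))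
      (Finset.sum_nonpos fun i _ => ?_)
    rw [sum_inner]
    exact Finset.sum_nonpos fun j _ => inner_collisionOp_sub_one_nonpos _ f
  rw [generatorFR, add_apply, add_apply, inner_add_left, inner_add_left]
  linarith [inner_generatorS_nonpos hlamS f, inner_generatorR_nonpos hlamR f]

theorem norm_exp_generatorFR_le (hlamS : 0 ≤ lamS) (hlamR : 0 ≤ lamR) (hmu : 0 ≤ mu) {s : ℝ}
    (hs : 0 ≤ s) (f : L2 β M N) :
    ‖NormedSpace.exp (s • generatorFR β M N lamS lamR mu) f‖ ≤ ‖f‖ := by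
  simpa using norm_exp_smul_apply_le (c := 0) (x := f) (fun r _ => by
    simpa using inner_generatorFR_nonpos hlamS hlamR hmu _) hs

theorem generatorS_apply_of_fixed {f : L2 β M N}
    (hf : ∀ i : Fin M, refreshOp β (Sum.inl i) f = f) : generatorS β M N lamS f = 0 := by
  rw [generatorS, smul_apply, sum_apply, Finset.sum_eq_zero, smul_zero]
  intro p _
  rw [sub_apply, one_apply_eq_self, collisionOp_apply_of_fixed β _ (hf _) (hf _), sub_self]

theorem generatorR_apply_of_mem {f : L2 β M N} (hf : f ∈ systemSubspace β M N) :
    generatorR β M N lamR f = 0 := by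
  rw [generatorR, smul_apply, sum_apply, Finset.sum_eq_zero, smul_zero]
  intro p _
  rw [sub_apply, one_apply_eq_self, collisionOp_apply_of_fixed β _ (hf _) (hf _), sub_self]

theorem generatorI_apply_of_fixed {f : L2 β M N} (hV : f ∈ systemSubspace β M N)
    (hf : ∀ i : Fin M, refreshOp β (Sum.inl i) f = f) : generatorI β M N mu f = 0 := by
  simp [generatorI_apply, interactionOp, fun i j => collisionOp_apply_of_fixed β
    (Sum.inl_ne_inr : (Sum.inl i : Fin M ⊕ Fin N) ≠ Sum.inr j) (hf i) (hV j)]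

theorem generatorT_apply_of_fixed {f : L2 β M N}
    (hf : ∀ i : Fin M, refreshOp β (Sum.inl i) f = f) : generatorT β M N mu f = 0 := by
  have h : ∀ i, thermostatOp β N i f = f := fun i => by
    have := thermostatOp_refreshOp_self β i f
    rwa [hf i] at this
  simp [generatorT_apply, h]

theorem systemMean_collisionOp {i k : Fin M} (hik : i ≠ k) (f : L2 β M N) :
    systemMean β M N (collisionOp β (Sum.inl_injective.ne hik) f) = systemMean β M N f := by
  have h : ∀ g : L2 β M N, systemMean β M N g =
      systemMean β M N (refreshOp β (Sum.inl i) (refreshOp β (Sum.inl k) g)) := fun g => by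
    rw [← refreshOp_systemMean_comm, ← refreshOp_systemMean_comm, refreshOp_systemMean,
      refreshOp_systemMean]
  rw [h, refreshOp_refreshOp_collisionOp, ← h]

theorem systemMean_thermostatOp (hN : 0 < N) {f : L2 β M N} (hf : f ∈ systemSubspace β M N)
    (i : Fin M) : systemMean β M N (thermostatOp β N i f) = systemMean β M N f := by
  rw [← refreshOp_systemMean i, refreshOp_systemMean_comm, refreshOp_thermostatOp_self (hf ⟨0, hN⟩),
    ← refreshOp_systemMean_comm, refreshOp_systemMean]

/-- System and thermostat collisions leave the reservoir velocities alone and preserve the system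
mean; the reservoir generator vanishes on functions of the system. -/
theorem generatorTh_mem (hN : 0 < N) {f : L2 β M N}
    (hf : f ∈ systemSubspace β M N ⊓ LinearMap.ker (systemMean β M N).toLinearMap) :
    generatorTh β M N lamS lamR mu f ∈
      systemSubspace β M N ⊓ LinearMap.ker (systemMean β M N).toLinearMap := by
  obtain ⟨hV, hE⟩ := hf
  replace hE : systemMean β M N f = 0 := hE
  have hS : generatorS β M N lamS f ∈
      systemSubspace β M N ⊓ LinearMap.ker (systemMean β M N).toLinearMap := by
    rw [generatorS, smul_apply, sum_apply]
    refine Submodule.smul_mem _ _ (Submodule.sum_mem _ fun p _ => ?_)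
    rw [sub_apply, one_apply_eq_self]
    refine ⟨Submodule.sub_mem _ (fun j => ?_) hV, ?_⟩
    · rw [refreshOp_collisionOp_comm β _ Sum.inr_ne_inl Sum.inr_ne_inl, hV j]
    · change systemMean β M N _ = 0
      rw [map_sub, systemMean_collisionOp p.2.ne, sub_self]
  have hT : generatorT β M N mu f ∈
      systemSubspace β M N ⊓ LinearMap.ker (systemMean β M N).toLinearMap := by
    rw [generatorT_apply]
    refine Submodule.smul_mem _ _ (Submodule.sum_mem _ fun i _ => ?_)
    refine ⟨Submodule.sub_mem _ (fun j => ?_) hV, ?_⟩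
    · rw [refreshOp_thermostatOp_comm β Sum.inr_ne_inl, hV j]
    · change systemMean β M N _ = 0
      rw [map_sub, systemMean_thermostatOp hN hV, sub_self]
  rw [generatorTh, add_apply, add_apply, generatorR_apply_of_mem hV, add_zero]
  exact Submodule.add_mem _ hS hT

/-- The spectral gap of the thermostated evolution on functions of the system velocities. -/
theorem inner_generatorTh_le (hN : 0 < N) (hlamS : 0 ≤ lamS) (hmu : 0 ≤ mu) {f : L2 β M N}
    (hV : f ∈ systemSubspace β M N) (hE : systemMean β M N f = 0) :
    inner ℝ (generatorTh β M N lamS lamR mu f) f ≤ -(mu / 2) * ‖f‖ ^ 2 := by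
  have hES := norm_sub_systemMean_sq_le f
  rw [hE, sub_zero] at hES
  have hT : inner ℝ (generatorT β M N mu f) f ≤ mu * (-(1 / 2) * ‖f‖ ^ 2) := by
    rw [generatorT_apply, inner_smul_left, sum_inner]
    refine mul_le_mul_of_nonneg_left ?_ hmu
    calc ∑ i, inner ℝ (thermostatOp β N i f - f) f
        ≤ ∑ i : Fin M, -(1 / 2) * ‖f - refreshOp β (Sum.inl i) f‖ ^ 2 := by
          refine Finset.sum_le_sum fun i _ => ?_
          rw [inner_sub_left, real_inner_self_eq_norm_sq]
          linarith [inner_thermostatOp_le (i := i) (hV ⟨0, hN⟩)]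
      _ ≤ -(1 / 2) * ‖f‖ ^ 2 := by
          rw [← Finset.mul_sum]
          linarith
  rw [generatorTh, add_apply, add_apply, generatorR_apply_of_mem hV, add_zero, inner_add_left]
  linarith [inner_generatorS_nonpos hlamS f]

theorem norm_generatorTh_sub_generatorFR_le (hN : 0 < N) (hmu : 0 ≤ mu) {f : L2 β M N}
    (hV : f ∈ systemSubspace β M N) :
    ‖(generatorTh β M N lamS lamR mu - generatorFR β M N lamS lamR mu) f‖ ≤
      M / Real.sqrt N * (mu / 2) * ‖f‖ := by
  have hN' : (0 : ℝ) < N := by exact_mod_cast hN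
  have heq : (generatorTh β M N lamS lamR mu - generatorFR β M N lamS lamR mu) f =
      (mu / N) • ∑ i, ∑ j, (thermostatOp β N i f - interactionOp β i j f) := by
    have h1 : ∀ i : Fin M, ∑ j : Fin N, (thermostatOp β N i f - interactionOp β i j f) =
        (N : ℝ) • (thermostatOp β N i f - f) - ∑ j : Fin N, (interactionOp β i j f - f) := by
      intro i
      simp only [Finset.sum_sub_distrib, Finset.sum_const, Finset.card_univ, Fintype.card_fin,
        ← Nat.cast_smul_eq_nsmul ℝ, smul_sub]
      abel
    simp only [h1]
    rw [Finset.sum_sub_distrib, ← Finset.smul_sum, smul_sub, smul_smul,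
      div_mul_cancel₀ _ hN'.ne', ← generatorT_apply, ← generatorI_apply, generatorTh, generatorFR,
      add_sub_add_left_eq_sub, sub_apply]
  rw [heq, norm_smul, Real.norm_of_nonneg (div_nonneg hmu hN'.le)]
  calc mu / N * ‖∑ i, ∑ j, (thermostatOp β N i f - interactionOp β i j f)‖
      ≤ mu / N * ∑ _i : Fin M, Real.sqrt N / 2 * ‖f‖ := by
        gcongr
        exact norm_sum_le_of_le _ fun i _ => norm_sum_thermostatOp_sub_interactionOp_le hV i
    _ = M / Real.sqrt N * (mu / 2) * ‖f‖ := by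
        rw [Finset.sum_const, Finset.card_univ, Fintype.card_fin, nsmul_eq_mul]
        have hs : Real.sqrt N ≠ 0 := (Real.sqrt_pos.2 hN').ne'
        have hs2 : Real.sqrt N * Real.sqrt N = N := Real.mul_self_sqrt hN'.le
        field_simp
        rw [sq, hs2]
        ring

end Dissipativity

/-! ### Constants and initial data -/

theorem refreshOp_const (β : ℝ≥0) {M N : ℕ} (a : Fin M ⊕ Fin N) (c : ℝ) :
    refreshOp β a (Lp.const 2 (maxwellian β M N) c) = Lp.const 2 (maxwellian β M N) c :=
  averageOp_toLp_of_invariant _ (memLp_const c) fun _ _ => rfl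

theorem toLp_mem_systemSubspace {β : ℝ≥0} {M N : ℕ} {h₀ : (Fin M → ℝ) → ℝ}
    (hh₀ : MemLp (fun x : Velocities M N => h₀ (fun i => x (Sum.inl i))) 2 (maxwellian β M N)) :
    hh₀.toLp _ ∈ systemSubspace β M N := fun j =>
  averageOp_toLp_of_invariant _ hh₀ fun x u => by simp [refreshMap]

end KacReservoir

end

theorem mainTheorem1 (β : ℝ≥0) (hβ : 0 < β) (M N : ℕ) (hN : 0 < N)
    (lamS lamR mu : ℝ) (hlamS : 0 ≤ lamS) (hlamR : 0 ≤ lamR) (hmu : 0 ≤ mu)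
    (h₀ : (Fin M → ℝ) → ℝ)
    (hh₀ : MemLp (fun x : KacReservoir.Velocities M N => h₀ (fun i => x (Sum.inl i))) 2 (KacReservoir.maxwellian β M N))
    (t : ℝ) (ht : 0 < t) :
    ‖NormedSpace.exp (t • KacReservoir.generatorTh β M N lamS lamR mu) (hh₀.toLp _) -
        NormedSpace.exp (t • KacReservoir.generatorFR β M N lamS lamR mu) (hh₀.toLp _)‖ ≤
      (M : ℝ) / Real.sqrt N * (1 - Real.exp (-(mu / 2) * t)) *
        ‖hh₀.toLp _ - Lp.const 2 (KacReservoir.maxwellian β M N) (1 : ℝ)‖ := by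
  open KacReservoir in
  set h : L2 β M N := hh₀.toLp _
  set A := generatorTh β M N lamS lamR mu with hA
  set B := generatorFR β M N lamS lamR mu with hB
  set E := systemMean β M N with hE
  set V := systemSubspace β M N ⊓ LinearMap.ker (systemMean β M N).toLinearMap
  have hV : h ∈ systemSubspace β M N := toLp_mem_systemSubspace hh₀
  have hEV : E h ∈ systemSubspace β M N := fun j => by
    rw [hE, refreshOp_systemMean_comm, hV j]
  have hEfix : ∀ i : Fin M, refreshOp β (Sum.inl i) (E h) = E h := fun i =>
    refreshOp_systemMean i h
  have hAE : A (E h) = 0 := by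
    rw [hA, generatorTh, add_apply, add_apply, generatorS_apply_of_fixed hEfix,
      generatorR_apply_of_mem hEV, generatorT_apply_of_fixed hEfix, add_zero, add_zero]
  have hBE : B (E h) = 0 := by
    rw [hB, generatorFR, add_apply, add_apply, generatorS_apply_of_fixed hEfix,
      generatorR_apply_of_mem hEV, generatorI_apply_of_fixed hEV hEfix, add_zero, add_zero]
  -- `E h` is stationary for both evolutions, so only the centred part `k` contributes.
  set k := h - E h with hk
  have hkV : k ∈ V := by
    refine ⟨Submodule.sub_mem _ hV hEV, ?_⟩
    change E (h - E h) = 0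
    rw [map_sub, hE, systemMean_eq_of_fixed hEfix, sub_self]
  have hclosed : IsClosed (V : Set (L2 β M N)) :=
    isClosed_systemSubspace.inter (isClosed_eq (systemMean β M N).continuous continuous_const)
  have hmem : ∀ s : ℝ, NormedSpace.exp (s • A) k ∈ V := fun s =>
    mem_of_exp_smul hclosed (fun x hx => generatorTh_mem hN hx) hkV s
  have hdecay : ∀ s : ℝ, 0 ≤ s →
      ‖NormedSpace.exp (s • A) k‖ ≤ Real.exp (-(mu / 2) * s) * ‖k‖ := fun s hs =>
    norm_exp_smul_apply_le (fun r _ => inner_generatorTh_le hN hlamS hmu (hmem r).1 (hmem r).2) hs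
  have hmain := norm_exp_sub_exp_le (A := A) (B := B) (x := k) (c := mu / 2)
    (K := M / Real.sqrt N * ‖k‖) (fun s hs y => norm_exp_generatorFR_le hlamS hlamR hmu hs y)
    (fun s hs => by
      refine (norm_generatorTh_sub_generatorFR_le hN hmu (hmem s).1).trans ?_
      calc M / Real.sqrt N * (mu / 2) * ‖NormedSpace.exp (s • A) k‖
          ≤ M / Real.sqrt N * (mu / 2) * (Real.exp (-(mu / 2) * s) * ‖k‖) := by
            gcongr
            exact hdecay s hs
        _ = _ := by ring) ht.le
  have hdiff : NormedSpace.exp (t • A) h - NormedSpace.exp (t • B) h =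
      NormedSpace.exp (t • A) k - NormedSpace.exp (t • B) k := by
    rw [hk, map_sub, map_sub, exp_smul_apply_of_eq_zero hAE, exp_smul_apply_of_eq_zero hBE,
      sub_sub_sub_cancel_right]
  -- The constant 1 is fixed by `E`, so `k` is also the image of `h - 1` under the contraction `I -
  -- E`.
  have hknorm : ‖k‖ ≤ ‖h - Lp.const 2 (maxwellian β M N) (1 : ℝ)‖ := by
    have h1 : E (Lp.const 2 (maxwellian β M N) (1 : ℝ)) = Lp.const 2 (maxwellian β M N) (1 : ℝ) :=
      systemMean_eq_of_fixed fun i => refreshOp_const β _ 1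
    have h2 := norm_sub_systemMean_le (h - Lp.const 2 (maxwellian β M N) (1 : ℝ))
    rwa [map_sub, ← hE, h1, sub_sub_sub_cancel_right] at h2
  have hexp : 0 ≤ 1 - Real.exp (-(mu / 2) * t) := by
    rw [sub_nonneg, Real.exp_le_one_iff]
    nlinarith
  rw [hdiff]
  calc _ ≤ M / Real.sqrt N * ‖k‖ * (1 - Real.exp (-(mu / 2) * t)) := hmain
    _ = M / Real.sqrt N * (1 - Real.exp (-(mu / 2) * t)) * ‖k‖ := by ring
    _ ≤ _ := by gcongr
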